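/- Let $K$ be an algebraically closed field of characteristic zero and let $Z=\{P_1,\dots,P_r\}$ be a finite set of points in the projective plane $\mathbb{P}^2$ over $K$. For a point $P$ let $I(P)\subset K[x_0,x_1,x_2]$ be its homogeneous ideal, for $m\ge 1$ put $I^{(m)}=I(P_1)^m\cap\dots\cap I(P_r)^m$, let $\alpha(I^{(m)})$ be the least degree of a nonzero homogeneous polynomial in $I^{(m)}$, and for $m>n$ put $\alpha_{m,n}(Z)=\alpha(I^{(m)})-\alpha(I^{(n)})$. If $\alpha_{k,k-1}(Z)=1$ for some integer $k\ge 2$, then - either the points of $Z$ are collinear, - or $Z$ is exactly the set of all intersection points of some arrangement of finitely many lines in $\mathbb{P}^2$, that is, the set of all points lying on at least two distinct lines of the arrangement. (The arrangement may be non-reduced, i.e. lines may be repeated, and degenerate, i.e. more than two of the lines may pass through one point.) -/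

import Mathlib

open scoped LinearAlgebra.Projectivization

namespace PlanePoints

/-- The projective plane over `K`. -/
abbrev Plane (K : Type*) [Field K] : Type _ := ℙ K (Fin 3 → K)

/-- The ideal `I(P)` of a point `P` in `K[x₀, x₁, x₂]`: the polynomials vanishing at all the
homogeneous coordinate vectors of `P`, that is, on the line through the origin of `K³` which `P`
stands for (the affine cone over `P`). -/
noncomputable def pointIdeal {K : Type*} [Field K] (P : Plane K) :
    Ideal (MvPolynomial (Fin 3) K) :=
  MvPolynomial.vanishingIdeal K (P.submodule : Set (Fin 3 → K))

/-- The `m`-th symbolic power `I(P₁)^m ∩ ⋯ ∩ I(P_r)^m` of the ideal of `Z = {P₁, …, P_r}`. -/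
noncomputable def symbolicPower {K : Type*} [Field K] (Z : Finset (Plane K)) (m : ℕ) :
    Ideal (MvPolynomial (Fin 3) K) :=
  ⨅ P ∈ Z, pointIdeal P ^ m

/-- The initial degree `α(I)`: the least degree of a nonzero homogeneous element of `I`. -/
noncomputable def initialDegree {K : Type*} [Field K] (I : Ideal (MvPolynomial (Fin 3) K)) : ℕ :=
  sInf {n : ℕ | ∃ f ∈ I, f ≠ 0 ∧ f.IsHomogeneous n}

/-- The difference `α_{m,n}(Z) = α(I^(m)) - α(I^(n))`, as an integer. -/
noncomputable def alphaDiff {K : Type*} [Field K] (m n : ℕ) (Z : Finset (Plane K)) : ℤ :=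
  (initialDegree (symbolicPower Z m) : ℤ) - (initialDegree (symbolicPower Z n) : ℤ)

/-- A line in the projective plane: a projective subspace whose cone has dimension two. -/
abbrev Line (K : Type*) [Field K] : Type _ :=
  {L : Projectivization.Subspace K (Fin 3 → K) // Module.finrank K L.submodule = 2}

/-- An arrangement of lines: finitely many lines, counted with multiplicities. Repeated lines
(non-reduced arrangements) and points lying on more than two of the lines (degenerate
arrangements) are allowed. -/
abbrev LineArrangement (K : Type*) [Field K] : Type _ := Multiset (Line K)

/-- The intersection points of an arrangement: the points common to two distinct lines of it.
Two copies of the same line do not contribute. -/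
def LineArrangement.intersectionPoints {K : Type*} [Field K] (A : LineArrangement K) :
    Set (Plane K) :=
  {P | ∃ L ∈ A, ∃ M ∈ A, L ≠ M ∧ P ∈ L.1 ∧ P ∈ M.1}

end PlanePoints

open MvPolynomial

namespace PlanePoints

variable {K : Type*} [Field K]

/-! Take a form `f` of least degree `d` with multiplicity at least `k` along `Z`. By hypothesis no
form of degree below `d - 1` has multiplicity at least `k - 1` along `Z`, so a modification of `f`
that costs two degrees must lose at least two in multiplicity at some point of `Z`.

This makes `f` a product of lines: an irreducible factor of degree `n ≥ 2` could be traded for an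
adjoint of degree `n - 2`, losing at most one at each point (`exists_adjoint`,
`isHomogeneous_one_of_mem`). Deleting two distinct lines also costs two degrees, so the two lines
meet in a point of `Z` (`exists_mem_of_lineOf_ne`). A point of `Z` on only one of the lines is
excluded unless `Z` is collinear (`isCollinear_or_eq_intersectionPoints`).

The adjoint comes from a parameter count. Bézout's inequality (`sum_mul_mult_le`) for the curve and
a polar through an extra point of it gives `1 + ∑ m (m - 1) ≤ n (n - 1)`, so the conditions imposed
on forms of degree `n - 2` are too few to exclude a nonzero solution. Bézout itself is proved by
comparing dimensions of spaces of forms and of jets. -/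

/-! ### Coordinates adapted to a point; restriction to a chart and homogenization -/

theorem exists_basis_zero_eq_rep (P : Plane K) :
    ∃ b : Module.Basis (Fin 3) K (Fin 3 → K), b 0 = P.rep := by
  obtain ⟨N, hN⟩ := Submodule.exists_isCompl (K ∙ P.rep)
  have hfin : Module.finrank K N = 2 := by
    have h := Submodule.finrank_add_eq_of_isCompl hN
    rw [finrank_span_singleton P.rep_nonzero, Module.finrank_fin_fun] at h
    omega
  refine ⟨Module.Basis.mkFinCons P.rep (Module.finBasisOfFinrankEq K N hfin) ?_ ?_, ?_⟩
  · intro c x hx hc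
    have h1 : c • P.rep ∈ (K ∙ P.rep) ⊓ N := by
      refine ⟨Submodule.smul_mem _ _ (Submodule.mem_span_singleton_self _), ?_⟩
      rw [eq_neg_of_add_eq_zero_left hc]
      exact N.neg_mem hx
    rw [hN.inf_eq_bot, Submodule.mem_bot] at h1
    exact (smul_eq_zero.mp h1).resolve_right P.rep_nonzero
  · intro z
    have hz : z ∈ (K ∙ P.rep) ⊔ N := by rw [hN.sup_eq_top]; trivial
    obtain ⟨y, hy, w, hw, rfl⟩ := Submodule.mem_sup.mp hz
    obtain ⟨a, rfl⟩ := Submodule.mem_span_singleton.mp hy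
    refine ⟨-a, ?_⟩
    have : a • P.rep + w + -a • P.rep = w := by module
    rwa [this]
  · simp

/-- A basis of `K³` whose first vector represents the point `P`. -/
noncomputable def frame (P : Plane K) : Module.Basis (Fin 3) K (Fin 3 → K) :=
  (exists_basis_zero_eq_rep P).choose

theorem frame_zero (P : Plane K) : frame P 0 = P.rep :=
  (exists_basis_zero_eq_rep P).choose_spec

/-- Restriction of polynomials to an affine chart of the plane with origin `P`. -/
noncomputable def affineChart (P : Plane K) :
    MvPolynomial (Fin 3) K →ₐ[K] MvPolynomial (Fin 2) K :=
  aeval fun i => C (frame P 0 i) + C (frame P 1 i) * X 0 + C (frame P 2 i) * X 1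

/-- The linear forms dual to the basis `frame P`. -/
noncomputable def coordForm (P : Plane K) (j : Fin 3) : MvPolynomial (Fin 3) K :=
  ∑ i, C ((frame P).coord j (Pi.single i 1)) * X i

theorem coordForm_isHomogeneous (P : Plane K) (j : Fin 3) : (coordForm P j).IsHomogeneous 1 :=
  IsHomogeneous.sum _ _ _ fun i _ => isHomogeneous_C_mul_X _ i

theorem sum_coord_mul (P : Plane K) (j : Fin 3) (v : Fin 3 → K) :
    ∑ i, (frame P).coord j (Pi.single i 1) * v i = (frame P).coord j v := by
  conv_rhs => rw [pi_eq_sum_univ' v]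
  simp only [map_sum, map_smul, smul_eq_mul]
  exact Finset.sum_congr rfl fun i _ => mul_comm _ _

theorem eval_coordForm (P : Plane K) (j : Fin 3) (v : Fin 3 → K) :
    eval v (coordForm P j) = (frame P).coord j v := by
  rw [← sum_coord_mul, coordForm]
  simp only [map_sum, map_mul, eval_C, eval_X]

theorem affineChart_coordForm (P : Plane K) (j : Fin 3) :
    affineChart P (coordForm P j) = C (if j = 0 then 1 else 0) + C (if j = 1 then 1 else 0) * X 0 +
      C (if j = 2 then 1 else 0) * X 1 := by
  have key (k : Fin 3) : (if j = k then (1 : K) else 0) =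
      ∑ i, (frame P).coord j (Pi.single i 1) * frame P k i := by
    rw [sum_coord_mul, Module.Basis.coord_apply, Module.Basis.repr_self, Finsupp.single_apply]
    simp [eq_comm]
  rw [key, key, key]
  simp only [coordForm, affineChart, map_sum, map_mul, aeval_X, algHom_C, algebraMap_eq,
    Finset.sum_mul, ← Finset.sum_add_distrib]
  exact Finset.sum_congr rfl fun i _ => by ring

@[simp] theorem affineChart_coordForm_zero (P : Plane K) : affineChart P (coordForm P 0) = 1 := by
  simp [affineChart_coordForm]

@[simp] theorem affineChart_coordForm_one (P : Plane K) :
    affineChart P (coordForm P 1) = X 0 := by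
  simp [affineChart_coordForm]

@[simp] theorem affineChart_coordForm_two (P : Plane K) :
    affineChart P (coordForm P 2) = X 1 := by
  simp [affineChart_coordForm]

theorem sum_frame_mul_coordForm (P : Plane K) (i : Fin 3) :
    ∑ j, C (frame P j i) * coordForm P j = X i := by
  simp only [coordForm, Finset.mul_sum, ← mul_assoc, ← map_mul]
  rw [Finset.sum_comm]
  have key (k : Fin 3) : ∑ j, frame P j i * (frame P).coord j (Pi.single k 1) =
      if k = i then 1 else 0 := by
    have h := congrFun ((frame P).sum_repr (Pi.single k 1)) i
    rw [Pi.single_apply] at h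
    simp only [Finset.sum_apply, Pi.smul_apply, smul_eq_mul] at h
    simp only [eq_comm (a := k), ← h, Module.Basis.coord_apply]
    exact Finset.sum_congr rfl fun _ _ => mul_comm _ _
  simp only [← Finset.sum_mul, ← map_sum, key]
  simp

/-- Homogenization to degree `t`, inverse to restriction to the affine chart at `P`. -/
noncomputable def homogenize (P : Plane K) (t : ℕ) :
    MvPolynomial (Fin 2) K →ₗ[K] MvPolynomial (Fin 3) K :=
  (basisMonomials (Fin 2) K).constr K fun d =>
    coordForm P 0 ^ (t - d 0 - d 1) * coordForm P 1 ^ d 0 * coordForm P 2 ^ d 1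

theorem homogenize_monomial (P : Plane K) (t : ℕ) (d : Fin 2 →₀ ℕ) :
    homogenize P t (monomial d 1) =
      coordForm P 0 ^ (t - d 0 - d 1) * coordForm P 1 ^ d 0 * coordForm P 2 ^ d 1 := by
  have h := (basisMonomials (Fin 2) K).constr_basis K (fun d =>
    coordForm P 0 ^ (t - d 0 - d 1) * coordForm P 1 ^ d 0 * coordForm P 2 ^ d 1) d
  rwa [coe_basisMonomials] at h

theorem homogenize_eq_sum (P : Plane K) (t : ℕ) (G : MvPolynomial (Fin 2) K) :
    homogenize P t G = ∑ d ∈ G.support, G.coeff d •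
      (coordForm P 0 ^ (t - d 0 - d 1) * coordForm P 1 ^ d 0 * coordForm P 2 ^ d 1) := by
  conv_lhs => rw [G.as_sum]
  rw [map_sum]
  refine Finset.sum_congr rfl fun d _ => ?_
  rw [← homogenize_monomial, ← map_smul, smul_monomial, smul_eq_mul, mul_one]

/-- Since `coordForm P 0` restricts to `1`, its truncated exponent is irrelevant here and no bound
on the degree of `G` is needed. -/
theorem affineChart_homogenize (P : Plane K) (t : ℕ) (G : MvPolynomial (Fin 2) K) :
    affineChart P (homogenize P t G) = G := by
  rw [homogenize_eq_sum]
  conv_rhs => rw [G.as_sum]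
  rw [map_sum]
  refine Finset.sum_congr rfl fun d _ => ?_
  simp [monomial_eq, Finsupp.prod_fintype, smul_eq_C_mul]

theorem homogenize_isHomogeneous (P : Plane K) {t : ℕ} {G : MvPolynomial (Fin 2) K}
    (hG : ∀ d ∈ G.support, d.degree ≤ t) : (homogenize P t G).IsHomogeneous t := by
  rw [homogenize_eq_sum]
  refine IsHomogeneous.sum _ _ _ fun d hd => ?_
  have h1 := hG d hd
  rw [Finsupp.degree_eq_sum, Fin.sum_univ_two] at h1
  rw [smul_eq_C_mul]
  refine IsHomogeneous.C_mul ?_ _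
  have h2 := (((coordForm_isHomogeneous P 0).pow (t - d 0 - d 1)).mul
    ((coordForm_isHomogeneous P 1).pow (d 0))).mul ((coordForm_isHomogeneous P 2).pow (d 1))
  convert h2 using 1
  omega

theorem aeval_coordForm_aeval (P : Plane K) (f : MvPolynomial (Fin 3) K) :
    aeval (coordForm P) (aeval (fun i => ∑ j, C (frame P j i) * X j) f :
      MvPolynomial (Fin 3) K) = f := by
  rw [← AlgHom.comp_apply]
  have : (aeval (coordForm P)).comp (aeval (fun i => ∑ j, C (frame P j i) * X j)) =
      AlgHom.id K (MvPolynomial (Fin 3) K) := by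
    ext1 i
    simpa [algHom_C, algebraMap_eq] using sum_frame_mul_coordForm P i
  rw [this, AlgHom.id_apply]

theorem affineChart_eq_aeval (P : Plane K) (f : MvPolynomial (Fin 3) K) :
    affineChart P f = aeval ![1, X 0, X 1] (aeval (fun i => ∑ j, C (frame P j i) * X j) f :
      MvPolynomial (Fin 3) K) := by
  rw [← AlgHom.comp_apply]
  congr 1
  ext1 i
  simp [affineChart, algHom_C, algebraMap_eq, Fin.sum_univ_three]

theorem homogenize_affineChart (P : Plane K) {t : ℕ} {f : MvPolynomial (Fin 3) K}
    (hf : f.IsHomogeneous t) : homogenize P t (affineChart P f) = f := by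
  -- `F` is `f` in the coordinates of the frame. The chart sets the first coordinate to `1`;
  -- homogeneity recovers its lost exponent as `t - d 1 - d 2`.
  set F : MvPolynomial (Fin 3) K := aeval (fun i => ∑ j, C (frame P j i) * X j) f with hF
  have hFh : F.IsHomogeneous t := by
    have := hf.aeval (n := 1) (fun i => ∑ j, C (frame P j i) * X j : Fin 3 → MvPolynomial (Fin 3) K)
      (fun i => IsHomogeneous.sum _ _ _ fun j _ => isHomogeneous_C_mul_X _ j)
    rwa [one_mul] at this
  rw [affineChart_eq_aeval, ← hF]
  conv_rhs => rw [← aeval_coordForm_aeval P f, ← hF]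
  conv_lhs => rw [F.as_sum]
  conv_rhs => rw [F.as_sum]
  simp only [map_sum]
  refine Finset.sum_congr rfl fun d hd => ?_
  have hdeg : d 0 + d 1 + d 2 = t := by
    have := hFh.degree_eq_sum_deg_support hd
    rw [this, ← Finsupp.degree_apply, Finsupp.degree_eq_sum, Fin.sum_univ_three]
  have h1 : aeval ![1, X 0, X 1] (monomial d (coeff d F)) =
      coeff d F • (monomial (Finsupp.single 0 (d 1) + Finsupp.single 1 (d 2)) 1 :
        MvPolynomial (Fin 2) K) := by
    rw [aeval_monomial, Finsupp.prod_fintype _ _ (by simp), Fin.prod_univ_three,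
      monomial_eq, Finsupp.prod_fintype _ _ (by simp)]
    simp [smul_eq_C_mul]
  rw [h1, map_smul, homogenize_monomial, aeval_monomial, Finsupp.prod_fintype _ _ (by simp),
    Fin.prod_univ_three, smul_eq_C_mul, algebraMap_eq]
  have h2 : t - d 1 - d 2 = d 0 := by omega
  simp [h2]

/-! ### Multiplicities and symbolic powers -/

/-- The multiplicity of (the curve defined by) `f` at the point `P`. -/
noncomputable def mult (P : Plane K) (f : MvPolynomial (Fin 3) K) : ℕ∞ :=
  (affineChart P f : MvPowerSeries (Fin 2) K).order

theorem mult_mul (P : Plane K) (f g : MvPolynomial (Fin 3) K) :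
    mult P (f * g) = mult P f + mult P g := by
  rw [mult, map_mul, coe_mul, MvPowerSeries.order_mul, mult, mult]

theorem mult_one (P : Plane K) : mult P 1 = 0 := by
  rw [mult, map_one, coe_one, MvPowerSeries.order, MvPowerSeries.weightedOrder_one]

theorem le_mult_iff (P : Plane K) (f : MvPolynomial (Fin 3) K) (m : ℕ) :
    (m : ℕ∞) ≤ mult P f ↔ ∀ d : Fin 2 →₀ ℕ, d.degree < m → coeff d (affineChart P f) = 0 := by
  constructor
  · intro h d hd
    rw [← coeff_coe]
    exact MvPowerSeries.coeff_of_lt_order (lt_of_lt_of_le (by exact_mod_cast hd) h)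
  · intro h
    refine MvPowerSeries.nat_le_order fun d hd => ?_
    rw [coeff_coe]
    exact h d hd

theorem mult_add_le (P : Plane K) (f g : MvPolynomial (Fin 3) K) :
    min (mult P f) (mult P g) ≤ mult P (f + g) := by
  rw [mult, mult, mult, map_add, coe_add]
  exact MvPowerSeries.min_order_le_add

theorem constantCoeff_affineChart (P : Plane K) (f : MvPolynomial (Fin 3) K) :
    constantCoeff (affineChart P f) = eval P.rep f := by
  have : (constantCoeff : MvPolynomial (Fin 2) K →+* K).comp (affineChart P : _ →+* _) =
      eval P.rep := by
    refine MvPolynomial.ringHom_ext (fun r => ?_) fun i => ?_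
    · simp [affineChart, algHom_C, algebraMap_eq]
    · simp [affineChart, frame_zero]
  exact congrFun (congrArg DFunLike.coe this) f

theorem one_le_mult_iff (P : Plane K) (f : MvPolynomial (Fin 3) K) :
    1 ≤ mult P f ↔ eval P.rep f = 0 := by
  rw [mult, MvPowerSeries.one_le_order_iff_constCoeff_eq_zero, ← constantCoeff_affineChart,
    ← MvPowerSeries.coeff_zero_eq_constantCoeff_apply, coeff_coe, constantCoeff_eq]

theorem mult_eq_zero_iff (P : Plane K) (f : MvPolynomial (Fin 3) K) :
    mult P f = 0 ↔ eval P.rep f ≠ 0 := by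
  rw [← not_iff_not, not_not, ← one_le_mult_iff, Order.one_le_iff_ne_zero]

theorem mult_ne_top {P : Plane K} {t : ℕ} {f : MvPolynomial (Fin 3) K}
    (hf : f.IsHomogeneous t) (h0 : f ≠ 0) : mult P f ≠ ⊤ := by
  intro h
  rw [mult, MvPowerSeries.order_eq_top_iff, coe_eq_zero_iff] at h
  apply h0
  rw [← homogenize_affineChart P hf, h, map_zero]

theorem le_mult_of_mem_pow {P : Plane K} {m : ℕ} {f : MvPolynomial (Fin 3) K}
    (hf : f ∈ pointIdeal P ^ m) : (m : ℕ∞) ≤ mult P f := by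
  induction m generalizing f with
  | zero => simp
  | succ m ih =>
    rw [pow_succ] at hf
    refine Submodule.mul_induction_on hf (fun a ha b hb => ?_) fun a b ha hb => ?_
    · rw [mult_mul]
      push_cast
      refine add_le_add (ih ha) ((one_le_mult_iff _ _).mpr ?_)
      have := hb P.rep (by rw [P.submodule_eq]; exact Submodule.mem_span_singleton_self _)
      simpa [aeval_eq_eval] using this
    · exact (le_min ha hb).trans (mult_add_le _ _ _)

theorem coordForm_mem_pointIdeal (P : Plane K) {j : Fin 3} (hj : j ≠ 0) :
    coordForm P j ∈ pointIdeal P := by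
  intro x hx
  rw [P.submodule_eq] at hx
  obtain ⟨a, rfl⟩ := Submodule.mem_span_singleton.mp hx
  rw [aeval_eq_eval, eval_coordForm, ← frame_zero, map_smul,
    Module.Basis.coord_apply, Module.Basis.repr_self, Finsupp.single_apply, if_neg hj.symm,
    smul_zero]

/-- Homogenizing the Taylor expansion at `P` writes `f` as a combination of monomials with at least
`m` factors among `coordForm P 1` and `coordForm P 2`, both of which lie in `pointIdeal P`. -/
theorem mem_pow_of_le_mult {P : Plane K} {m t : ℕ} {f : MvPolynomial (Fin 3) K}
    (hf : f.IsHomogeneous t) (hm : (m : ℕ∞) ≤ mult P f) : f ∈ pointIdeal P ^ m := by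
  rw [← homogenize_affineChart P hf, homogenize_eq_sum]
  refine Ideal.sum_mem _ fun d hd => ?_
  rw [smul_eq_C_mul, mul_assoc (coordForm P 0 ^ _)]
  refine Ideal.mul_mem_left _ _ (Ideal.mul_mem_left _ _ ?_)
  have hd' : m ≤ d 0 + d 1 := by
    by_contra! hlt
    refine mem_support_iff.mp hd ((le_mult_iff P f m).mp hm d ?_)
    rwa [Finsupp.degree_eq_sum, Fin.sum_univ_two]
  refine Ideal.pow_le_pow_right hd' ?_
  rw [pow_add]
  exact Ideal.mul_mem_mul
    (Ideal.pow_mem_pow (coordForm_mem_pointIdeal P (by decide)) _)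
    (Ideal.pow_mem_pow (coordForm_mem_pointIdeal P (by decide)) _)

theorem mem_symbolicPower_iff {Z : Finset (Plane K)} {m t : ℕ} {f : MvPolynomial (Fin 3) K}
    (hf : f.IsHomogeneous t) : f ∈ symbolicPower Z m ↔ ∀ P ∈ Z, (m : ℕ∞) ≤ mult P f := by
  simp only [symbolicPower, Submodule.mem_iInf]
  exact forall₂_congr fun P _ => ⟨le_mult_of_mem_pow, mem_pow_of_le_mult hf⟩

/-! ### Derivatives, and factors of homogeneous polynomials -/

theorem pderiv_mem_pow {R σ : Type*} [CommRing R] {I : Ideal (MvPolynomial σ R)} {m : ℕ}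
    {f : MvPolynomial σ R} (i : σ) (hf : f ∈ I ^ (m + 1)) : pderiv i f ∈ I ^ m := by
  induction m generalizing f with
  | zero => simp
  | succ m ih =>
    rw [pow_succ] at hf
    refine Submodule.mul_induction_on hf (fun a ha b hb => ?_) fun a b ha hb => ?_
    · rw [Derivation.leibniz, smul_eq_mul, smul_eq_mul]
      refine Ideal.add_mem _ (Ideal.mul_mem_right _ _ ha) ?_
      rw [mul_comm, pow_succ]
      exact Ideal.mul_mem_mul (ih ha) hb
    · rw [map_add]
      exact Ideal.add_mem _ ha hb

/-- The derivative in the direction `v`. -/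
noncomputable def dirDeriv (v : Fin 3 → K) (f : MvPolynomial (Fin 3) K) :
    MvPolynomial (Fin 3) K :=
  ∑ i, C (v i) * pderiv i f

theorem dirDeriv_isHomogeneous (v : Fin 3 → K) {t : ℕ} {f : MvPolynomial (Fin 3) K}
    (hf : f.IsHomogeneous t) : (dirDeriv v f).IsHomogeneous (t - 1) :=
  IsHomogeneous.sum _ _ _ fun _ _ => hf.pderiv.C_mul _

theorem le_mult_dirDeriv {P : Plane K} {m t : ℕ} {f : MvPolynomial (Fin 3) K}
    (hf : f.IsHomogeneous t) (hm : ((m + 1 : ℕ) : ℕ∞) ≤ mult P f) (v : Fin 3 → K) :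
    (m : ℕ∞) ≤ mult P (dirDeriv v f) :=
  le_mult_of_mem_pow (Ideal.sum_mem _ fun i _ =>
    Ideal.mul_mem_left _ _ (pderiv_mem_pow i (mem_pow_of_le_mult hf hm)))

theorem order_coe_le_totalDegree {σ R : Type*} [CommSemiring R] {f : MvPolynomial σ R}
    (hf : f ≠ 0) : (f : MvPowerSeries σ R).order ≤ f.totalDegree := by
  obtain ⟨d, hd⟩ := ne_zero_iff.mp hf
  refine (MvPowerSeries.order_le (d := d) (by rwa [coeff_coe])).trans ?_
  have := le_totalDegree (mem_support_iff.mpr hd)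
  exact_mod_cast this

/-- Over a domain the lowest and the highest degree occurring are both additive. They agree on the
product, hence on each factor. -/
theorem isHomogeneous_of_mul {σ R : Type*} [CommRing R] [IsDomain R] {n : ℕ}
    {f g : MvPolynomial σ R} (h : (f * g).IsHomogeneous n) (h0 : f * g ≠ 0) :
    f.IsHomogeneous f.totalDegree ∧ g.IsHomogeneous g.totalDegree ∧
      f.totalDegree + g.totalDegree = n := by
  have hf := left_ne_zero_of_mul h0
  have hg := right_ne_zero_of_mul h0
  have hdeg : f.totalDegree + g.totalDegree = n := by
    rw [← totalDegree_mul_of_isDomain hf hg, h.totalDegree h0]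
  have hord : (n : ℕ∞) ≤ (f : MvPowerSeries σ R).order + (g : MvPowerSeries σ R).order := by
    rw [← MvPowerSeries.order_mul, ← coe_mul]
    refine MvPowerSeries.nat_le_order fun d hd => ?_
    rw [coeff_coe]
    exact h.coeff_eq_zero hd.ne
  have hf1 := order_coe_le_totalDegree hf
  have hg1 := order_coe_le_totalDegree hg
  rw [← hdeg] at hord
  lift (f : MvPowerSeries σ R).order to ℕ using ne_top_of_le_ne_top (ENat.natCast_ne_top _) hf1
    with a ha
  lift (g : MvPowerSeries σ R).order to ℕ using ne_top_of_le_ne_top (ENat.natCast_ne_top _) hg1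
    with b hb
  norm_cast at hord hf1 hg1
  have key (p : MvPolynomial σ R) (hp : (p.totalDegree : ℕ∞) ≤ (p : MvPowerSeries σ R).order) :
      p.IsHomogeneous p.totalDegree := by
    intro d hd
    have h1 := le_totalDegree (mem_support_iff.mpr hd)
    have h2 := hp.trans (MvPowerSeries.order_le (d := d) (by rwa [coeff_coe]))
    change Finsupp.weight (fun _ => 1) d = _
    rw [← Finsupp.degree_eq_weight_one]
    norm_cast at h2
    refine le_antisymm ?_ h2
    exact h1
  refine ⟨key f ?_, key g ?_, hdeg⟩
  · rw [← ha]; norm_cast; omega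
  · rw [← hb]; norm_cast; omega

/-! ### Dimensions of spaces of forms and of jets -/

/-- The exponents of the monomials of degree less than `c` in two variables. -/
noncomputable def exponents (c : ℕ) : Finset (Fin 2 →₀ ℕ) :=
  (Finset.range c).biUnion fun n => Finset.finsuppAntidiag Finset.univ n

theorem mem_exponents {c : ℕ} {d : Fin 2 →₀ ℕ} : d ∈ exponents c ↔ d.degree < c := by
  simp [exponents, Finset.mem_finsuppAntidiag, Finsupp.degree_eq_sum]

/-- All the counts are doubled to avoid division by two, which lets `omega` combine them. -/
theorem two_mul_card_exponents (c : ℕ) : 2 * (exponents c).card = c * (c + 1) := by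
  rw [exponents, Finset.card_biUnion]
  · simp only [Finset.card_finsuppAntidiag_nat_eq_choose, Finset.card_univ, Fintype.card_fin]
    induction c with
    | zero => simp
    | succ c ih =>
      rw [Finset.sum_range_succ, mul_add, ih, show 2 + c - 1 = c + 1 by omega,
        Nat.choose_succ_self_right]
      ring
  · intro i _ j _ hij
    refine Finset.disjoint_left.mpr fun d hi hj => hij ?_
    rw [Finset.mem_finsuppAntidiag] at hi hj
    exact hi.1.symm.trans hj.1

instance (t : ℕ) : Module.Finite K (homogeneousSubmodule (Fin 3) K t) :=
  Module.Finite.iff_fg.mpr (homogeneousSubmodule_fg (Fin 3) K t)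

theorem two_mul_finrank_homogeneousSubmodule (t : ℕ) :
    2 * Module.finrank K (homogeneousSubmodule (Fin 3) K t) = (t + 1) * (t + 2) := by
  have hset : {d : Fin 3 →₀ ℕ | d.degree = t} =
      (Finset.finsuppAntidiag Finset.univ t : Finset (Fin 3 →₀ ℕ)) := by
    ext d
    simp [Finset.mem_finsuppAntidiag, Finsupp.degree_eq_sum]
  rw [homogeneousSubmodule_eq_finsupp_supported, hset]
  rw [(AddMonoidAlgebra.supportedEquivFinsupp (S := K) (R := K)
    ((Finset.finsuppAntidiag Finset.univ t : Finset (Fin 3 →₀ ℕ)) : Set (Fin 3 →₀ ℕ))).finrank_eq,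
    Module.finrank_finsupp_self]
  simp only [Finset.coe_sort_coe, Fintype.card_coe, Finset.card_finsuppAntidiag_nat_eq_choose,
    Finset.card_univ, Fintype.card_fin]
  rw [show 3 + t - 1 = t + 2 by omega, Nat.choose_symm_of_eq_add (show t + 2 = t + 2 from rfl),
    Nat.choose_two_right, mul_comm,
    Nat.div_mul_cancel (Nat.even_mul_pred_self _).two_dvd, show t + 2 - 1 = t + 1 by omega, mul_comm]

/-- The Taylor coefficients of `F` of order less than `c P` at the points `P` of `Z`. -/
noncomputable def jets (Z : Finset (Plane K)) (c : Plane K → ℕ) :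
    MvPolynomial (Fin 3) K →ₗ[K] ((P : Z) → exponents (c P) → K) :=
  LinearMap.pi fun P => LinearMap.pi fun d =>
    (lcoeff K (d : Fin 2 →₀ ℕ)) ∘ₗ (affineChart (P : Plane K)).toLinearMap

theorem jets_apply (Z : Finset (Plane K)) (c : Plane K → ℕ) (F : MvPolynomial (Fin 3) K) (P : Z)
    (d : exponents (c P)) : jets Z c F P d = coeff d (affineChart (P : Plane K) F) := rfl

theorem jets_apply_eq_zero {Z : Finset (Plane K)} {c : Plane K → ℕ} {F : MvPolynomial (Fin 3) K}
    {P : Z} : jets Z c F P = 0 ↔ (c P : ℕ∞) ≤ mult (P : Plane K) F := by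
  rw [le_mult_iff]
  constructor
  · intro h d hd
    exact congrFun h ⟨d, mem_exponents.mpr hd⟩
  · intro h
    ext d
    exact h d (mem_exponents.mp d.2)

theorem jets_eq_zero {Z : Finset (Plane K)} {c : Plane K → ℕ} {F : MvPolynomial (Fin 3) K} :
    jets Z c F = 0 ↔ ∀ P ∈ Z, (c P : ℕ∞) ≤ mult P F := by
  constructor
  · intro h P hP
    exact (jets_apply_eq_zero (P := ⟨P, hP⟩)).mp (congrFun h ⟨P, hP⟩)
  · intro h
    funext P
    exact jets_apply_eq_zero.mpr (h P P.2)

theorem two_mul_finrank_jets (Z : Finset (Plane K)) (c : Plane K → ℕ) :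
    2 * Module.finrank K ((P : Z) → exponents (c P) → K) = ∑ P ∈ Z, c P * (c P + 1) := by
  rw [Module.finrank_pi_fintype, Finset.mul_sum, ← Finset.sum_coe_sort Z]
  refine Finset.sum_congr rfl fun P _ => ?_
  rw [Module.finrank_fintype_fun_eq_card, Fintype.card_coe, two_mul_card_exponents]

/-- Multiplicity `c P` at `P` amounts to `c P * (c P + 1) / 2` linear conditions, fewer in total
than the dimension of the space of forms. -/
theorem exists_le_mult {Z : Finset (Plane K)} {c : Plane K → ℕ} {s : ℕ}
    (h : ∑ P ∈ Z, c P * (c P + 1) < (s + 1) * (s + 2)) :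
    ∃ q : MvPolynomial (Fin 3) K, q ≠ 0 ∧ q.IsHomogeneous s ∧ ∀ P ∈ Z, (c P : ℕ∞) ≤ mult P q := by
  have hlt : Module.finrank K ((P : Z) → exponents (c P) → K) <
      Module.finrank K (homogeneousSubmodule (Fin 3) K s) := by
    have h1 := two_mul_finrank_jets Z c
    have h2 := two_mul_finrank_homogeneousSubmodule (K := K) s
    omega
  have hker := LinearMap.ker_ne_bot_of_finrank_lt
    (f := (jets Z c) ∘ₗ (homogeneousSubmodule (Fin 3) K s).subtype) hlt
  obtain ⟨q, hq, hq0⟩ := Submodule.exists_mem_ne_zero_of_ne_bot hker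
  refine ⟨q, fun h => hq0 (Subtype.ext h), q.2, jets_eq_zero.mp (LinearMap.mem_ker.mp hq)⟩

/-! ### Surjectivity of the jet map in large degree -/

theorem exists_linearForm_separating {P Q : Plane K} (h : Q ≠ P) :
    ∃ l : MvPolynomial (Fin 3) K, l.IsHomogeneous 1 ∧ 1 ≤ mult Q l ∧ mult P l = 0 := by
  by_contra! hcon
  have h1 (j : Fin 3) (hj : j ≠ 0) : (frame Q).coord j P.rep = 0 := by
    have := hcon (coordForm Q j) (coordForm_isHomogeneous Q j)
      ((one_le_mult_iff _ _).mpr (by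
        rw [eval_coordForm, ← frame_zero, Module.Basis.coord_apply, Module.Basis.repr_self,
          Finsupp.single_apply, if_neg hj.symm]))
    rwa [Ne, mult_eq_zero_iff, not_not, eval_coordForm] at this
  have h2 := (frame Q).sum_repr P.rep
  rw [Fin.sum_univ_three] at h2
  simp only [← Module.Basis.coord_apply, h1 1 (by decide), h1 2 (by decide), zero_smul, add_zero,
    frame_zero] at h2
  refine h ?_
  rw [← P.mk_rep, ← Q.mk_rep, eq_comm, Projectivization.mk_eq_mk_iff']
  exact ⟨_, h2⟩

theorem mult_pow (P : Plane K) (f : MvPolynomial (Fin 3) K) (n : ℕ) :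
    mult P (f ^ n) = n * mult P f := by
  induction n with
  | zero => simp [mult_one]
  | succ n ih => rw [pow_succ, mult_mul, ih]; push_cast; ring

theorem mult_prod {ι : Type*} (P : Plane K) (s : Finset ι) (f : ι → MvPolynomial (Fin 3) K) :
    mult P (∏ i ∈ s, f i) = ∑ i ∈ s, mult P (f i) := by
  classical
  induction s using Finset.induction_on with
  | empty => simp [mult_one]
  | insert a s ha ih => rw [Finset.prod_insert ha, Finset.sum_insert ha, mult_mul, ih]

theorem exists_separating_form (Z : Finset (Plane K)) (c : Plane K → ℕ) (P : Plane K) :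
    ∃ (n : ℕ) (e : MvPolynomial (Fin 3) K), e.IsHomogeneous n ∧ mult P e = 0 ∧
      ∀ Q ∈ Z, Q ≠ P → (c Q : ℕ∞) ≤ mult Q e := by
  classical
  have h (Q : Plane K) : ∃ l : MvPolynomial (Fin 3) K, Q ≠ P →
      l.IsHomogeneous 1 ∧ 1 ≤ mult Q l ∧ mult P l = 0 := by
    -- No form separates `P` from itself; the value `0` only makes the choice total.
    by_cases hQ : Q = P
    · exact ⟨0, fun h => absurd hQ h⟩
    · exact (exists_linearForm_separating hQ).imp fun _ h _ => h
  choose l hl using h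
  refine ⟨_, ∏ Q ∈ Z.erase P, l Q ^ c Q, IsHomogeneous.prod _ _ _ fun Q hQ =>
    (hl Q (Finset.ne_of_mem_erase hQ)).1.pow (c Q), ?_, fun Q hQ hne => ?_⟩
  · rw [mult_prod]
    refine Finset.sum_eq_zero fun Q hQ => ?_
    rw [mult_pow, (hl Q (Finset.ne_of_mem_erase hQ)).2.2, mul_zero]
  · have hQ' : Q ∈ Z.erase P := Finset.mem_erase.mpr ⟨hne, hQ⟩
    rw [mult_prod]
    refine le_trans ?_ (Finset.single_le_sum (f := fun Q' => mult Q (l Q' ^ c Q'))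
      (fun _ _ => zero_le) hQ')
    rw [mult_pow]
    exact le_mul_of_one_le_right zero_le (hl Q hne).2.1

/-- The polynomial with prescribed coefficients of degree less than `c`. -/
noncomputable def ofJet (c : ℕ) : (exponents c → K) →ₗ[K] MvPolynomial (Fin 2) K where
  toFun w := ∑ d : exponents c, monomial (d : Fin 2 →₀ ℕ) (w d)
  map_add' v w := by simp [Finset.sum_add_distrib]
  map_smul' a w := by simp [Finset.smul_sum, smul_monomial]

theorem coeff_ofJet (c : ℕ) (w : exponents c → K) (d : exponents c) :
    coeff (d : Fin 2 →₀ ℕ) (ofJet c w) = w d := by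
  classical
  simp [ofJet, coeff_sum, coeff_monomial]

theorem coeff_ofJet_of_notMem (c : ℕ) (w : exponents c → K) {d : Fin 2 →₀ ℕ}
    (hd : d ∉ exponents c) : coeff d (ofJet c w) = 0 := by
  classical
  change coeff d (∑ e : exponents c, monomial (e : Fin 2 →₀ ℕ) (w e)) = 0
  rw [coeff_sum]
  simp only [coeff_monomial]
  refine Finset.sum_eq_zero fun e _ => if_neg ?_
  rintro rfl
  exact hd e.2

/-- Multiplication by a polynomial of order zero preserves orders, so it is injective on jets, hence
surjective by finite dimension. -/
theorem exists_mul_jet_eq {c : ℕ} {ε : MvPolynomial (Fin 2) K} (hε : constantCoeff ε ≠ 0)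
    (w : exponents c → K) :
    ∃ v : exponents c → K, ∀ d : exponents c, coeff (d : Fin 2 →₀ ℕ) (ε * ofJet c v) = w d := by
  let Φ : (exponents c → K) →ₗ[K] (exponents c → K) :=
    (LinearMap.pi fun d : exponents c => lcoeff K (d : Fin 2 →₀ ℕ)) ∘ₗ
      (LinearMap.mulLeft K ε) ∘ₗ ofJet c
  have hinj : Function.Injective Φ := by
    refine (injective_iff_map_eq_zero Φ).mpr fun v hv => ?_
    have h1 : (c : ℕ∞) ≤ ((ε * ofJet c v : MvPolynomial (Fin 2) K) :
        MvPowerSeries (Fin 2) K).order := by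
      refine MvPowerSeries.nat_le_order fun d hd => ?_
      rw [coeff_coe]
      exact congrFun hv ⟨d, mem_exponents.mpr hd⟩
    have h0 : (ε : MvPowerSeries (Fin 2) K).order = 0 := by
      by_contra h
      rw [← Ne, MvPowerSeries.order_ne_zero_iff_constCoeff_eq_zero,
        ← MvPowerSeries.coeff_zero_eq_constantCoeff_apply, coeff_coe] at h
      exact hε h
    rw [coe_mul, MvPowerSeries.order_mul, h0, zero_add] at h1
    ext d
    rw [← coeff_ofJet c v d, ← coeff_coe]
    exact MvPowerSeries.coeff_of_lt_order
      (lt_of_lt_of_le (by exact_mod_cast mem_exponents.mp d.2) h1)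
  obtain ⟨v, hv⟩ := LinearMap.injective_iff_surjective.mp hinj w
  exact ⟨v, fun d => congrFun hv d⟩

/-- A form that vanishes to high order at the other points but not at `P` is multiplied by a form
whose jet at `P` corrects for it. -/
theorem exists_jets_eq_single (Z : Finset (Plane K)) (c : Plane K → ℕ) (P : Z) :
    ∃ t₀ : ℕ, ∀ t ≥ t₀, ∀ w : exponents (c P) → K, ∃ F : MvPolynomial (Fin 3) K,
      F.IsHomogeneous t ∧ jets Z c F P = w ∧ ∀ Q : Z, Q ≠ P → jets Z c F Q = 0 := by
  obtain ⟨n, e, hen, heP, heQ⟩ := exists_separating_form Z c (P : Plane K)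
  refine ⟨n + c P, fun t ht w => ?_⟩
  have hε : constantCoeff (affineChart (P : Plane K) e) ≠ 0 := by
    rw [constantCoeff_affineChart]
    exact (mult_eq_zero_iff _ _).mp heP
  obtain ⟨v, hv⟩ := exists_mul_jet_eq hε w
  refine ⟨e * homogenize (P : Plane K) (t - n) (ofJet _ v), ?_, ?_, fun Q hQ => ?_⟩
  · have h : (homogenize (P : Plane K) (t - n) (ofJet _ v)).IsHomogeneous (t - n) := by
      refine homogenize_isHomogeneous _ fun d hd => ?_
      by_contra hlt
      refine mem_support_iff.mp hd (coeff_ofJet_of_notMem _ _ fun hmem => ?_)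
      have := mem_exponents.mp hmem
      omega
    have h2 := hen.mul h
    rwa [show n + (t - n) = t by omega] at h2
  · ext d
    rw [jets_apply, map_mul, affineChart_homogenize]
    exact hv d
  · rw [jets_apply_eq_zero, mult_mul]
    exact (heQ Q Q.2 (fun h => hQ (Subtype.ext h))).trans le_self_add

theorem exists_jets_surjective (Z : Finset (Plane K)) (c : Plane K → ℕ) :
    ∃ t₀ : ℕ, ∀ t ≥ t₀,
      Function.Surjective ((jets Z c) ∘ₗ (homogeneousSubmodule (Fin 3) K t).subtype) := by
  classical
  choose t₀ ht₀ using exists_jets_eq_single Z c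
  refine ⟨∑ P, t₀ P, fun t ht w => ?_⟩
  have h (P : Z) := ht₀ P t ((Finset.single_le_sum (fun _ _ => Nat.zero_le _)
    (Finset.mem_univ P)).trans ht) (w P)
  choose F hF hFP hFQ using h
  refine ⟨⟨∑ P, F P, IsHomogeneous.sum _ _ _ fun P _ => hF P⟩, ?_⟩
  funext Q
  simp only [LinearMap.comp_apply, Submodule.subtype_apply, map_sum, Finset.sum_apply]
  rw [Finset.sum_eq_single Q (fun P _ hP => hFQ P Q hP.symm) (by simp), hFP]

/-! ### Bézout's inequality -/

theorem mul_mem_homogeneousSubmodule {a s t : ℕ} (h : a + s = t) {f : MvPolynomial (Fin 3) K}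
    (hf : f.IsHomogeneous a) (u : homogeneousSubmodule (Fin 3) K s) :
    f * (u : MvPolynomial (Fin 3) K) ∈ homogeneousSubmodule (Fin 3) K t :=
  h ▸ hf.mul u.2

/-- Multiplication by a homogeneous polynomial between graded pieces. -/
noncomputable def mulForm {a s t : ℕ} (h : a + s = t) {f : MvPolynomial (Fin 3) K}
    (hf : f.IsHomogeneous a) :
    homogeneousSubmodule (Fin 3) K s →ₗ[K] homogeneousSubmodule (Fin 3) K t :=
  ((LinearMap.mulLeft K f) ∘ₗ (homogeneousSubmodule (Fin 3) K s).subtype).codRestrict _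
    (mul_mem_homogeneousSubmodule h hf)

theorem coe_mulForm {a s t : ℕ} (h : a + s = t) {f : MvPolynomial (Fin 3) K}
    (hf : f.IsHomogeneous a) (u : homogeneousSubmodule (Fin 3) K s) :
    (mulForm h hf u : MvPolynomial (Fin 3) K) = f * u := rfl

theorem finrank_range_le_of_ker_le {V W W' : Type*} [AddCommGroup V] [Module K V]
    [FiniteDimensional K V] [AddCommGroup W] [Module K W] [AddCommGroup W'] [Module K W']
    [FiniteDimensional K W'] {f : V →ₗ[K] W} {g : V →ₗ[K] W'}
    (h : LinearMap.ker g ≤ LinearMap.ker f) :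
    Module.finrank K (LinearMap.range f) ≤ Module.finrank K W' := by
  have h1 := LinearMap.finrank_range_add_finrank_ker f
  have h2 := LinearMap.finrank_range_add_finrank_ker g
  have h3 := Submodule.finrank_mono h
  have h4 := Submodule.finrank_le (LinearMap.range g)
  omega

/-- The rank lost on composing `ψ` with `J` is the dimension of `range ψ ⊓ ker J`, at most `dim V -
dim W`. -/
theorem finrank_add_finrank_range_le {U V W : Type*} [AddCommGroup U] [Module K U]
    [AddCommGroup V] [Module K V] [FiniteDimensional K V] [AddCommGroup W] [Module K W]
    {J : V →ₗ[K] W} (hJ : Function.Surjective J) (ψ : U →ₗ[K] V) :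
    Module.finrank K W + Module.finrank K (LinearMap.range ψ) ≤
      Module.finrank K V + Module.finrank K (LinearMap.range (J ∘ₗ ψ)) := by
  have h1 := LinearMap.finrank_range_add_finrank_ker J
  rw [LinearMap.range_eq_top.mpr hJ, finrank_top] at h1
  have h2 := LinearMap.finrank_range_add_finrank_ker (J.domRestrict (LinearMap.range ψ))
  rw [LinearMap.range_domRestrict, ← LinearMap.range_comp] at h2
  have h3 : Module.finrank K (LinearMap.ker (J.domRestrict (LinearMap.range ψ))) ≤
      Module.finrank K (LinearMap.ker J) :=
    LinearMap.finrank_le_finrank_of_injective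
      (f := ((LinearMap.range ψ).subtype ∘ₗ Submodule.subtype _).codRestrict (LinearMap.ker J)
        fun x => x.2)
      fun _ _ hxy => by
        have h := congrArg Subtype.val hxy
        exact Subtype.ext (Subtype.ext h)
  omega

/-- Bézout's inequality for two plane curves without common components. -/
theorem sum_mul_mult_le {Z : Finset (Plane K)} {m n : Plane K → ℕ} {a b : ℕ}
    {f h : MvPolynomial (Fin 3) K} (hf : f.IsHomogeneous a) (hh : h.IsHomogeneous b)
    (hh0 : h ≠ 0) (hrel : ∀ u v, f * u = h * v → h ∣ u)
    (hm : ∀ P ∈ Z, (m P : ℕ∞) ≤ mult P f) (hn : ∀ P ∈ Z, (n P : ℕ∞) ≤ mult P h) :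
    ∑ P ∈ Z, m P * n P ≤ a * b := by
  obtain ⟨s, hs⟩ := exists_jets_surjective Z (fun P => m P + n P)
  let t := a + b + s
  have hsurj := hs t (by omega)
  -- The degree `t` part of the ideal `(f, h)` is the range of `ψ`; by `hrel` its syzygies are the
  -- Koszul ones, parametrized by `κ`.
  let ψ : (homogeneousSubmodule (Fin 3) K (b + s) × homogeneousSubmodule (Fin 3) K (a + s)) →ₗ[K]
      homogeneousSubmodule (Fin 3) K t :=
    (mulForm (by omega) hf).coprod (mulForm (by omega) hh)
  have hψ (x) : (ψ x : MvPolynomial (Fin 3) K) = f * x.1 + h * x.2 := by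
    simp [ψ, coe_mulForm]
  let κ : homogeneousSubmodule (Fin 3) K s →ₗ[K]
      (homogeneousSubmodule (Fin 3) K (b + s) × homogeneousSubmodule (Fin 3) K (a + s)) :=
    (mulForm rfl hh).prod (-(mulForm rfl hf))
  have hker : LinearMap.ker ψ ≤ LinearMap.range κ := by
    rintro ⟨u, v⟩ huv
    have h1 : f * (u : MvPolynomial (Fin 3) K) + h * v = 0 := by
      rw [← hψ (u, v), LinearMap.mem_ker.mp huv]; rfl
    obtain ⟨w, hw⟩ := hrel u (-v) (by linear_combination h1)
    have hv : (v : MvPolynomial (Fin 3) K) = -(f * w) := by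
      apply mul_left_cancel₀ hh0
      rw [hw] at h1
      linear_combination h1
    -- The zero form is set apart because its total degree need not be `s`.
    by_cases hw0 : w = 0
    · refine ⟨0, ?_⟩
      rw [map_zero, eq_comm, Prod.mk_eq_zero]
      exact ⟨Subtype.ext (by rw [hw, hw0, mul_zero]; rfl),
        Subtype.ext (by rw [hv, hw0, mul_zero, neg_zero]; rfl)⟩
    · have hu2 : (h * w).IsHomogeneous (b + s) := hw ▸ u.2
      obtain ⟨-, h3, h4⟩ := isHomogeneous_of_mul hu2 (mul_ne_zero hh0 hw0)
      have h5 : w.totalDegree = s := by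
        rw [hh.totalDegree hh0] at h4
        omega
      refine ⟨⟨w, h5 ▸ h3⟩, ?_⟩
      refine Prod.ext (Subtype.ext hw.symm) (Subtype.ext ?_)
      simpa [κ, coe_mulForm] using hv.symm
  let Ψ := ((jets Z (fun P => m P + n P)) ∘ₗ (homogeneousSubmodule (Fin 3) K t).subtype) ∘ₗ ψ
  let Θ : (homogeneousSubmodule (Fin 3) K (b + s) × homogeneousSubmodule (Fin 3) K (a + s)) →ₗ[K]
      (((P : Z) → exponents (n P) → K) × ((P : Z) → exponents (m P) → K)) :=
    ((jets Z n) ∘ₗ (homogeneousSubmodule (Fin 3) K (b + s)).subtype).prodMap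
      ((jets Z m) ∘ₗ (homogeneousSubmodule (Fin 3) K (a + s)).subtype)
  -- As `f` already vanishes to order `m P` and `h` to order `n P`, the jet of `f * u + h * v` of
  -- order `m P + n P` depends only on the `n P`-jet of `u` and the `m P`-jet of `v`.
  have hkerΨ : LinearMap.ker Θ ≤ LinearMap.ker Ψ := by
    rintro ⟨u, v⟩ huv
    obtain ⟨hu, hv⟩ := Prod.mk_eq_zero.mp (LinearMap.mem_ker.mp huv)
    suffices h : jets Z (fun P => m P + n P) (ψ (u, v) : MvPolynomial (Fin 3) K) = 0 from h
    refine jets_eq_zero.mpr fun P hP => ?_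
    rw [hψ]
    refine (le_min ?_ ?_).trans (mult_add_le _ _ _)
    · rw [mult_mul]
      push_cast
      exact add_le_add (hm P hP) (jets_eq_zero.mp hu P hP)
    · rw [mult_mul, add_comm (mult P h)]
      push_cast
      exact add_le_add (jets_eq_zero.mp hv P hP) (hn P hP)
  have r1 := finrank_range_le_of_ker_le hkerΨ
  rw [Module.finrank_prod] at r1
  have r2 := LinearMap.finrank_range_add_finrank_ker ψ
  rw [Module.finrank_prod] at r2
  have r3 := Submodule.finrank_mono hker
  have r4 := LinearMap.finrank_range_add_finrank_ker κ
  have r5 : _ ≤ _ + Module.finrank K (LinearMap.range Ψ) :=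
    finrank_add_finrank_range_le hsurj ψ
  have d1 := two_mul_finrank_homogeneousSubmodule (K := K) t
  have d2 := two_mul_finrank_homogeneousSubmodule (K := K) (a + s)
  have d3 := two_mul_finrank_homogeneousSubmodule (K := K) (b + s)
  have d4 := two_mul_finrank_homogeneousSubmodule (K := K) s
  have e1 := two_mul_finrank_jets Z (fun P => m P + n P)
  have e2 := two_mul_finrank_jets Z m
  have e3 := two_mul_finrank_jets Z n
  -- The cross terms `2 * m P * n P` and, in `d5`, `2 * (a * b)` are what survives in the comparison
  -- of dimensions.
  have e4 : ∑ P ∈ Z, (m P + n P) * (m P + n P + 1) = ∑ P ∈ Z, m P * (m P + 1) +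
      ∑ P ∈ Z, n P * (n P + 1) + 2 * ∑ P ∈ Z, m P * n P := by
    rw [Finset.mul_sum, ← Finset.sum_add_distrib, ← Finset.sum_add_distrib]
    exact Finset.sum_congr rfl fun P _ => by ring
  have d5 : (t + 1) * (t + 2) + (s + 1) * (s + 2) =
      (a + s + 1) * (a + s + 2) + (b + s + 1) * (b + s + 2) + 2 * (a * b) := by
    simp only [t]; ring
  omega

/-! ### Further points of a curve, polars and adjoints -/

theorem le_of_dvd_of_isHomogeneous {a b : ℕ} {g h : MvPolynomial (Fin 3) K}
    (hg : g.IsHomogeneous a) (hh : h.IsHomogeneous b) (h0 : h ≠ 0) (hdvd : g ∣ h) : a ≤ b := by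
  obtain ⟨u, rfl⟩ := hdvd
  rw [← hg.totalDegree (left_ne_zero_of_mul h0), ← (isHomogeneous_of_mul hh h0).2.2]
  exact Nat.le_add_right _ _

theorem eval_smul_of_isHomogeneous {n : ℕ} {g : MvPolynomial (Fin 3) K} (hg : g.IsHomogeneous n)
    (a : K) (x : Fin 3 → K) : eval (a • x) g = a ^ n * eval x g := by
  rw [eval_eq, eval_eq, Finset.mul_sum]
  refine Finset.sum_congr rfl fun d hd => ?_
  simp only [Pi.smul_apply, smul_eq_mul, mul_pow, Finset.prod_mul_distrib]
  rw [Finset.prod_pow_eq_pow_sum, hg.degree_eq_sum_deg_support hd]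
  ring

theorem coordForm_ne_zero (P : Plane K) : coordForm P 1 ≠ 0 := by
  intro h
  have := affineChart_coordForm_one P
  rw [h, map_zero] at this
  exact X_ne_zero _ this.symm

theorem eval_rep_coordForm_one (P : Plane K) : eval P.rep (coordForm P 1) = 0 := by
  rw [eval_coordForm, ← frame_zero, Module.Basis.coord_apply, Module.Basis.repr_self,
    Finsupp.single_apply, if_neg (by decide)]

theorem exists_smul_rep_eq {x : Fin 3 → K} (hx : x ≠ 0) :
    ∃ a : K, a • (Projectivization.mk K x hx).rep = x := by
  have h := (Projectivization.mk K x hx).mk_rep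
  rw [eq_comm, Projectivization.mk_eq_mk_iff'] at h
  exact h

theorem eval_rep_mk_eq_zero {n : ℕ} {g : MvPolynomial (Fin 3) K} (hg : g.IsHomogeneous n)
    {x : Fin 3 → K} (hx : x ≠ 0) (h : eval x g = 0) :
    eval (Projectivization.mk K x hx).rep g = 0 := by
  obtain ⟨a, ha⟩ := exists_smul_rep_eq hx
  rw [← ha, eval_smul_of_isHomogeneous hg] at h
  refine (mul_eq_zero.mp h).resolve_left (pow_ne_zero _ ?_)
  rintro rfl
  rw [zero_smul] at ha
  exact hx ha.symm

theorem exists_point_on_curve_notMem [IsAlgClosed K] {n : ℕ} (hn : 2 ≤ n)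
    {g : MvPolynomial (Fin 3) K} (hg : g.IsHomogeneous n) (hp : Prime g)
    (Z : Finset (Plane K)) : ∃ P : Plane K, P ∉ Z ∧ eval P.rep g = 0 := by
  -- By the Nullstellensatz `g` has a zero where `h` does not vanish. The factor `X 0` keeps it away
  -- from the origin, the other factors away from the points of `Z`.
  set h : MvPolynomial (Fin 3) K := X 0 * ∏ Q ∈ Z, coordForm Q 1 with hh
  have hnot : ¬ g ∣ h := by
    intro hdvd
    rcases hp.dvd_or_dvd hdvd with h1 | h1
    · have := le_of_dvd_of_isHomogeneous hg (isHomogeneous_X K 0) (X_ne_zero _) h1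
      omega
    · obtain ⟨Q, -, h2⟩ := (hp.dvd_finsetProd_iff _).mp h1
      have := le_of_dvd_of_isHomogeneous hg (coordForm_isHomogeneous Q 1) (coordForm_ne_zero Q) h2
      omega
  have hprime : (Ideal.span {g}).IsPrime := (Ideal.span_singleton_prime hp.ne_zero).mpr hp
  rw [← Ideal.mem_span_singleton, ← IsPrime.vanishingIdeal_zeroLocus (K := K) (Ideal.span {g}),
    mem_vanishingIdeal_iff] at hnot
  push Not at hnot
  obtain ⟨x, hx, hxh⟩ := hnot
  rw [zeroLocus_span] at hx
  have hxg : eval x g = 0 := by simpa [aeval_eq_eval] using hx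
  have hxh' : x 0 * ∏ Q ∈ Z, eval x (coordForm Q 1) ≠ 0 := by
    simpa [hh, aeval_eq_eval] using hxh
  have hx0 : x ≠ 0 := by
    rintro rfl
    exact left_ne_zero_of_mul hxh' rfl
  refine ⟨Projectivization.mk K x hx0, fun hmem => ?_, eval_rep_mk_eq_zero hg hx0 hxg⟩
  refine right_ne_zero_of_mul hxh' (Finset.prod_eq_zero hmem ?_)
  obtain ⟨a, ha⟩ := exists_smul_rep_eq hx0
  refine (congrArg (fun y => eval y (coordForm (Projectivization.mk K x hx0) 1)) ha).symm.trans ?_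
  rw [eval_smul_of_isHomogeneous (coordForm_isHomogeneous _ _), eval_rep_coordForm_one, mul_zero]

theorem exists_pderiv_ne_zero [CharZero K] {n : ℕ} (hn : n ≠ 0) {g : MvPolynomial (Fin 3) K}
    (hg : g.IsHomogeneous n) (h0 : g ≠ 0) : ∃ i, pderiv i g ≠ 0 := by
  by_contra! h
  have := hg.sum_X_mul_pderiv
  simp only [h, mul_zero, Finset.sum_const_zero] at this
  rw [eq_comm, smul_eq_zero] at this
  tauto

theorem dirDeriv_single (i : Fin 3) (g : MvPolynomial (Fin 3) K) :
    dirDeriv (Pi.single i 1) g = pderiv i g := by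
  rw [dirDeriv, Finset.sum_eq_single i] <;> simp +contextual

theorem dirDeriv_sub_smul (a b : K) (i j : Fin 3) (g : MvPolynomial (Fin 3) K) :
    dirDeriv (a • Pi.single i 1 - b • Pi.single j 1) g =
      C a * pderiv i g - C b * pderiv j g := by
  rw [← dirDeriv_single i, ← dirDeriv_single j]
  simp only [dirDeriv, Finset.mul_sum, ← Finset.sum_sub_distrib]
  refine Finset.sum_congr rfl fun _ _ => ?_
  simp only [Pi.sub_apply, Pi.smul_apply, smul_eq_mul, map_sub, map_mul]
  ring

/-- Otherwise the gradient of `g` would be a constant vector times one partial derivative. Euler's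
identity would then make `g` divide a linear form times that derivative, and both have degree below
`n`. -/
theorem exists_polar_through [CharZero K] {n : ℕ} (hn : 2 ≤ n) {g : MvPolynomial (Fin 3) K}
    (hg : g.IsHomogeneous n) (hp : Prime g) (x : Fin 3 → K) :
    ∃ v, dirDeriv v g ≠ 0 ∧ eval x (dirDeriv v g) = 0 := by
  by_contra! hcon
  obtain ⟨i₀, hi₀⟩ := exists_pderiv_ne_zero (by omega) hg hp.ne_zero
  have ha : eval x (pderiv i₀ g) ≠ 0 := by
    have := hcon (Pi.single i₀ 1)
    rw [dirDeriv_single] at this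
    exact this hi₀
  set a : Fin 3 → K := fun i => eval x (pderiv i g) with ha_def
  have hrel (i : Fin 3) : C (a i₀) * pderiv i g = C (a i) * pderiv i₀ g := by
    by_contra hne
    refine hcon (a i₀ • Pi.single i 1 - a i • Pi.single i₀ 1) ?_ ?_
    · rw [dirDeriv_sub_smul]
      exact sub_ne_zero.mpr hne
    · rw [dirDeriv_sub_smul]
      simp [ha_def, mul_comm]
  have heuler : C (a i₀) * (n • g) = (∑ i, C (a i) * X i) * pderiv i₀ g := by
    rw [← hg.sum_X_mul_pderiv, Finset.mul_sum, Finset.sum_mul]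
    refine Finset.sum_congr rfl fun i _ => ?_
    linear_combination X i * hrel i
  have hne : C (a i₀) * (n • g) ≠ 0 :=
    mul_ne_zero (by simpa using ha) (smul_ne_zero (by omega) hp.ne_zero)
  have hdvd : g ∣ (∑ i, C (a i) * X i) * pderiv i₀ g := by
    rw [← heuler, nsmul_eq_mul]
    exact Dvd.intro_left _ (mul_assoc _ _ _)
  rw [heuler] at hne
  rcases hp.dvd_or_dvd hdvd with h | h
  · have := le_of_dvd_of_isHomogeneous hg
      (IsHomogeneous.sum _ _ _ fun i _ => isHomogeneous_C_mul_X (a i) i) (left_ne_zero_of_mul hne) h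
    omega
  · have := le_of_dvd_of_isHomogeneous hg hg.pderiv (right_ne_zero_of_mul hne) h
    omega

/-- Adjoint curves: an irreducible plane curve of degree `n ≥ 2` has an adjoint curve of degree
`n - 2`. -/
theorem exists_adjoint [IsAlgClosed K] [CharZero K] {n : ℕ} (hn : 2 ≤ n)
    {g : MvPolynomial (Fin 3) K} (hg : g.IsHomogeneous n) (hp : Prime g) (Z : Finset (Plane K)) :
    ∃ q : MvPolynomial (Fin 3) K, q ≠ 0 ∧ q.IsHomogeneous (n - 2) ∧
      ∀ P ∈ Z, mult P g ≤ mult P q + 1 := by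
  classical
  obtain ⟨R, hRZ, hR⟩ := exists_point_on_curve_notMem hn hg hp Z
  obtain ⟨v, hv0, hv⟩ := exists_polar_through hn hg hp R.rep
  have hh := dirDeriv_isHomogeneous v hg
  choose m hm using fun P => ENat.ne_top_iff_exists.mp (mult_ne_top (P := P) hg hp.ne_zero)
  have hne {P : Plane K} (hP : P ∈ Z) : P ≠ R := fun h => hRZ (h ▸ hP)
  -- The polar has multiplicity at least `m P - 1` on `Z`. The extra common point `R` contributes
  -- `1`, which makes the count needed for `exists_le_mult` strict.
  have hbez := sum_mul_mult_le (Z := insert R Z) (m := fun P => if P = R then 1 else m P)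
    (n := fun P => if P = R then 1 else m P - 1) hg hh hv0 (fun u w huw => ?_) ?_ ?_
  · rw [Finset.sum_insert hRZ] at hbez
    simp only [if_pos, mul_one] at hbez
    rw [Finset.sum_congr rfl fun P hP => by rw [if_neg (hne hP), if_neg (hne hP)]] at hbez
    obtain ⟨q, hq0, hq, hqZ⟩ := exists_le_mult (Z := Z) (c := fun P => m P - 1) (s := n - 2) (by
      have h1 : ∑ P ∈ Z, (m P - 1) * (m P - 1 + 1) ≤ ∑ P ∈ Z, m P * (m P - 1) := by
        refine Finset.sum_le_sum fun P _ => ?_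
        rcases Nat.eq_zero_or_pos (m P) with h | h
        · simp [h]
        · rw [Nat.sub_add_cancel h, mul_comm]
      have h2 : (n - 2 + 1) * (n - 2 + 2) = n * (n - 1) := by
        rw [Nat.sub_add_cancel hn, mul_comm]
        congr 1
        omega
      omega)
    refine ⟨q, hq0, hq, fun P hP => ?_⟩
    rw [← hm P]
    refine le_trans ?_ (add_le_add_left (hqZ P hP) 1)
    norm_cast
    omega
  · have hdvd : g ∣ dirDeriv v g * w := ⟨u, huw.symm⟩
    rcases hp.dvd_or_dvd hdvd with h | ⟨w', rfl⟩
    · have := le_of_dvd_of_isHomogeneous hg hh hv0 h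
      omega
    · refine ⟨w', mul_left_cancel₀ hp.ne_zero ?_⟩
      rw [huw]
      ring
  · intro P hP
    split_ifs with h
    · rw [h, Nat.cast_one, one_le_mult_iff, hR]
    · exact (hm P).le
  · intro P hP
    split_ifs with h
    · rw [h, Nat.cast_one, one_le_mult_iff, hv]
    · rcases Nat.eq_zero_or_pos (m P) with h0 | h0
      · simp [h0]
      · refine le_mult_dirDeriv hg ?_ v
        rw [Nat.sub_add_cancel h0]
        exact (hm P).le

/-! ### Linear forms and lines -/

/-- The linear functional on `K³` with the coefficients of the linear part of `g`. -/
noncomputable def linearPart (g : MvPolynomial (Fin 3) K) : (Fin 3 → K) →ₗ[K] K :=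
  ∑ i, coeff (Finsupp.single i 1) g • LinearMap.proj i

theorem linearPart_apply {g : MvPolynomial (Fin 3) K} (hg : g.IsHomogeneous 1) (x : Fin 3 → K) :
    linearPart g x = eval x g := by
  rw [← mem_homogeneousSubmodule, homogeneousSubmodule_one_eq_span_X] at hg
  induction hg using Submodule.span_induction with
  | mem p hp =>
    obtain ⟨i, rfl⟩ := hp
    simp [linearPart, coeff_X, Finsupp.single_left_inj, eq_comm]
  | zero => simp [linearPart]
  | add p q _ _ hp hq =>
    rw [map_add, ← hp, ← hq]
    simp [linearPart, add_mul, Finset.sum_add_distrib]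
  | smul a p _ hp =>
    rw [smul_eval, ← hp]
    simp [linearPart, mul_assoc, Finset.mul_sum]

theorem linearPart_ne_zero {g : MvPolynomial (Fin 3) K} (hg : g.IsHomogeneous 1) (h0 : g ≠ 0) :
    linearPart g ≠ 0 := by
  intro h
  obtain ⟨d, hd⟩ := ne_zero_iff.mp h0
  have hdeg := hg.degree_eq_sum_deg_support (mem_support_iff.mpr hd)
  obtain ⟨i, rfl⟩ := (Finsupp.sum_eq_one_iff d).mp hdeg.symm
  have := congrFun (congrArg DFunLike.coe h) (Pi.single i 1)
  refine hd ?_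
  simpa [linearPart, Pi.single_apply] using this

/-- The line defined by a nonzero linear form. -/
noncomputable def lineOf (g : MvPolynomial (Fin 3) K) (hg : g.IsHomogeneous 1) (h0 : g ≠ 0) :
    Line K :=
  ⟨(LinearMap.ker (linearPart g)).projectivization, by
    rw [OrderIso.apply_symm_apply]
    have := Module.Dual.finrank_ker_add_one_of_ne_zero (linearPart_ne_zero hg h0)
    rw [Module.finrank_fin_fun] at this
    exact Nat.succ_injective this⟩

theorem mem_lineOf_iff {g : MvPolynomial (Fin 3) K} (hg : g.IsHomogeneous 1) (h0 : g ≠ 0)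
    (P : Plane K) : P ∈ (lineOf g hg h0).1 ↔ 1 ≤ mult P g := by
  rw [one_le_mult_iff, ← linearPart_apply hg, ← LinearMap.mem_ker, lineOf,
    Submodule.mem_projectivization_iff_submodule_le, P.submodule_eq,
    Submodule.span_singleton_le_iff_mem]

theorem mem_iff_submodule_le (P : Plane K) (L : Projectivization.Subspace K (Fin 3 → K)) :
    P ∈ L ↔ P.submodule ≤ Projectivization.Subspace.submodule L := by
  rw [← Submodule.mem_projectivization_iff_submodule_le, OrderIso.symm_apply_apply]

theorem finrank_inf_eq_one {L M : Line K} (h : L ≠ M) :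
    Module.finrank K ((Projectivization.Subspace.submodule L.1 ⊓
      Projectivization.Subspace.submodule M.1 : Submodule K (Fin 3 → K))) = 1 := by
  set U := Projectivization.Subspace.submodule L.1 with hU
  set V := Projectivization.Subspace.submodule M.1 with hV
  have hU2 : Module.finrank K U = 2 := L.2
  have hV2 : Module.finrank K V = 2 := M.2
  have h1 := Submodule.finrank_sup_add_finrank_inf_eq U V
  have h2 := Submodule.finrank_le (U ⊔ V)
  rw [Module.finrank_fin_fun] at h2
  have h3 : Module.finrank K (U ⊓ V : Submodule K (Fin 3 → K)) ≠ 2 := by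
    intro h4
    have e1 := Submodule.eq_of_le_of_finrank_eq (inf_le_left : U ⊓ V ≤ U) (h4.trans hU2.symm)
    have e2 := Submodule.eq_of_le_of_finrank_eq (inf_le_right : U ⊓ V ≤ V) (h4.trans hV2.symm)
    refine h (Subtype.ext (Projectivization.Subspace.submodule.injective ?_))
    exact e1.symm.trans e2
  have h5 := Submodule.finrank_mono (inf_le_left : U ⊓ V ≤ U)
  omega

theorem eq_of_mem_lines {L M : Line K} (h : L ≠ M) {P Q : Plane K} (hPL : P ∈ L.1) (hPM : P ∈ M.1)
    (hQL : Q ∈ L.1) (hQM : Q ∈ M.1) : P = Q := by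
  have key {P : Plane K} (hPL : P ∈ L.1) (hPM : P ∈ M.1) :
      P.submodule = Projectivization.Subspace.submodule L.1 ⊓
        Projectivization.Subspace.submodule M.1 := by
    rw [mem_iff_submodule_le] at hPL hPM
    exact Submodule.eq_of_le_of_finrank_eq (le_inf hPL hPM)
      (P.finrank_submodule.trans (finrank_inf_eq_one h).symm)
  exact Projectivization.submodule_injective ((key hPL hPM).trans (key hQL hQM).symm)

theorem mult_le_one {g : MvPolynomial (Fin 3) K} (hg : g.IsHomogeneous 1) (h0 : g ≠ 0)
    (P : Plane K) : mult P g ≤ 1 := by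
  have hne : affineChart P g ≠ 0 := fun h => h0 (by rw [← homogenize_affineChart P hg, h, map_zero])
  refine (order_coe_le_totalDegree hne).trans ?_
  rw [← mem_homogeneousSubmodule, homogeneousSubmodule_one_eq_span_X] at hg
  norm_cast
  clear h0 hne
  induction hg using Submodule.span_induction with
  | mem p hp =>
    obtain ⟨i, rfl⟩ := hp
    have hX (a : K) (j : Fin 2) : (C a * X j : MvPolynomial (Fin 2) K).totalDegree ≤ 1 :=
      (isHomogeneous_C_mul_X a j).totalDegree_le
    rw [affineChart, aeval_X]
    refine (totalDegree_add _ _).trans (max_le ((totalDegree_add _ _).trans (max_le ?_ (hX _ _)))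
      (hX _ _))
    simp
  | zero => simp
  | add p q _ _ hp hq =>
    rw [map_add]
    exact (totalDegree_add _ _).trans (max_le hp hq)
  | smul a p _ hp =>
    rw [map_smul]
    exact (totalDegree_smul_le _ _).trans hp

theorem mult_multiset_prod (P : Plane K) (s : Multiset (MvPolynomial (Fin 3) K)) :
    mult P s.prod = (s.map (mult P)).sum := by
  induction s using Multiset.induction_on with
  | empty => simp [mult_one]
  | cons a s ih => simp [mult_mul, ih]

/-- Multiplicities are additive and nonnegative, so a unit has multiplicity zero. -/
theorem mult_eq_of_associated {f g : MvPolynomial (Fin 3) K} (h : Associated f g)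
    (P : Plane K) : mult P f = mult P g := by
  obtain ⟨u, rfl⟩ := h
  have hu : mult P (u : MvPolynomial (Fin 3) K) + mult P ((u⁻¹ : _ˣ) : MvPolynomial (Fin 3) K) =
      0 := by
    rw [← mult_mul, Units.mul_inv, mult_one]
  rw [mult_mul, (add_eq_zero.mp hu).1, add_zero]

/-! ### Curves of minimal degree -/

section Minimal

variable {Z : Finset (Plane K)} {k d : ℕ} {s : Multiset (MvPolynomial (Fin 3) K)}

theorem natCast_pred_le {k : ℕ} {x : ℕ∞} (h : (k : ℕ∞) ≤ x + 1) : ((k - 1 : ℕ) : ℕ∞) ≤ x := by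
  rw [ENat.natCast_sub, Nat.cast_one]
  exact tsub_le_iff_right.mpr h

/-- If no curve of degree less than `d - 1` has multiplicity at least `k - 1` along `Z`, then a curve
of degree `d` with multiplicity at least `k` along `Z` consists of lines. -/
theorem isHomogeneous_one_of_mem [IsAlgClosed K] [CharZero K]
    (hs : ∀ g ∈ s, Prime g) (hd : s.prod.IsHomogeneous d)
    (hk : ∀ P ∈ Z, (k : ℕ∞) ≤ mult P s.prod)
    (hmin : ∀ (q : MvPolynomial (Fin 3) K) (e : ℕ), q ≠ 0 → q.IsHomogeneous e →
      (∀ P ∈ Z, ((k - 1 : ℕ) : ℕ∞) ≤ mult P q) → d ≤ e + 1)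
    {g : MvPolynomial (Fin 3) K} (hg : g ∈ s) : g.IsHomogeneous 1 := by
  obtain ⟨s', rfl⟩ := Multiset.exists_cons_of_mem hg
  have h0 : g * s'.prod ≠ 0 := by
    rw [← Multiset.prod_cons]
    exact Multiset.prod_ne_zero fun h => (hs 0 h).ne_zero rfl
  rw [Multiset.prod_cons] at hd hk
  obtain ⟨h1, h2, h3⟩ := isHomogeneous_of_mul hd h0
  have hgp := hs g hg
  have hpos : g.totalDegree ≠ 0 := fun h => hgp.not_isUnit (by
    rw [totalDegree_eq_zero_iff_eq_C] at h
    have hc : coeff 0 g ≠ 0 := fun hc => hgp.ne_zero (by rw [h, hc, map_zero])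
    rw [h]
    exact (isUnit_iff_ne_zero.mpr hc).map C)
  have hlt : g.totalDegree < 2 := by
    by_contra! hge
    -- Replacing `g` by its adjoint gives degree `d - 2` and multiplicity at least `k - 1` along
    -- `Z`, against `hmin`.
    obtain ⟨q, hq0, hq, hqZ⟩ := exists_adjoint hge h1 hgp Z
    have := hmin (q * s'.prod) _ (mul_ne_zero hq0 (right_ne_zero_of_mul h0)) (hq.mul h2)
      fun P hP => natCast_pred_le ?_
    · omega
    · refine (hk P hP).trans ?_
      rw [mult_mul, mult_mul, add_right_comm]
      exact add_le_add_left (hqZ P hP) _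
  rwa [show g.totalDegree = 1 by omega] at h1

/-- Without `l` and `m` the degree is `d - 2`, so `hmin` fails at some `P` in `Z`, where at least
two in multiplicity were lost. Each linear form accounts for at most one, so both pass through `P`.
-/
theorem exists_mem_of_lineOf_ne (hs : ∀ g ∈ s, g.IsHomogeneous 1) (hs0 : ∀ g ∈ s, g ≠ 0)
    (hd : s.prod.IsHomogeneous d) (hk : ∀ P ∈ Z, (k : ℕ∞) ≤ mult P s.prod)
    (hmin : ∀ (q : MvPolynomial (Fin 3) K) (e : ℕ), q ≠ 0 → q.IsHomogeneous e →
      (∀ P ∈ Z, ((k - 1 : ℕ) : ℕ∞) ≤ mult P q) → d ≤ e + 1)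
    {l m : MvPolynomial (Fin 3) K} (hl : l ∈ s) (hm : m ∈ s)
    (hlm : lineOf l (hs l hl) (hs0 l hl) ≠ lineOf m (hs m hm) (hs0 m hm)) :
    ∃ s' : Multiset (MvPolynomial (Fin 3) K), s = l ::ₘ m ::ₘ s' ∧
      ∃ P ∈ Z, P ∈ (lineOf l (hs l hl) (hs0 l hl)).1 ∧ P ∈ (lineOf m (hs m hm) (hs0 m hm)).1 ∧
        ¬ ((k - 1 : ℕ) : ℕ∞) ≤ mult P s'.prod := by
  obtain ⟨s₁, h1⟩ := Multiset.exists_cons_of_mem hl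
  have hm1 : m ∈ s₁ := by
    have := hm
    rw [h1, Multiset.mem_cons] at this
    refine this.resolve_left ?_
    rintro rfl
    exact hlm rfl
  obtain ⟨s', h2⟩ := Multiset.exists_cons_of_mem hm1
  have hs' : s = l ::ₘ m ::ₘ s' := by rw [h1, h2]
  refine ⟨s', hs', ?_⟩
  have h0 : s.prod ≠ 0 := Multiset.prod_ne_zero fun h => hs0 0 h rfl
  have hprod : s.prod = l * m * s'.prod := by rw [hs', Multiset.prod_cons, Multiset.prod_cons,
    mul_assoc]
  rw [hprod] at h0 hd hk
  obtain ⟨-, h3, h4⟩ := isHomogeneous_of_mul hd h0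
  have h5 : (l * m).totalDegree = 2 :=
    ((hs l hl).mul (hs m hm)).totalDegree (left_ne_zero_of_mul h0)
  obtain ⟨P, hP, hlt⟩ : ∃ P ∈ Z, ¬ ((k - 1 : ℕ) : ℕ∞) ≤ mult P s'.prod := by
    by_contra! hcon
    have := hmin s'.prod _ (right_ne_zero_of_mul h0) h3 hcon
    omega
  have hle := hk P hP
  rw [mult_mul, mult_mul] at hle
  have hl1 := mult_le_one (hs l hl) (hs0 l hl) P
  have hm1 := mult_le_one (hs m hm) (hs0 m hm) P
  refine ⟨P, hP, ?_, ?_, hlt⟩ <;> rw [mem_lineOf_iff] <;> by_contra hcon <;>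
    refine hlt (natCast_pred_le (hle.trans ?_)) <;>
    rw [add_comm] <;> refine add_le_add_right ?_ _
  · rw [Order.one_le_iff_ne_zero, not_not] at hcon
    rwa [hcon, zero_add]
  · rw [Order.one_le_iff_ne_zero, not_not] at hcon
    rwa [hcon, add_zero]

/-- The lines defined by a multiset of linear forms. -/
noncomputable def linesOf (s : Multiset (MvPolynomial (Fin 3) K))
    (hs : ∀ g ∈ s, g.IsHomogeneous 1) (hs0 : ∀ g ∈ s, g ≠ 0) : LineArrangement K :=
  s.attach.map fun g => lineOf g.1 (hs g.1 g.2) (hs0 g.1 g.2)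

theorem mem_linesOf {hs : ∀ g ∈ s, g.IsHomogeneous 1} {hs0 : ∀ g ∈ s, g ≠ 0} {L : Line K} :
    L ∈ linesOf s hs hs0 ↔ ∃ (g : _) (hg : g ∈ s), lineOf g (hs g hg) (hs0 g hg) = L := by
  simp [linesOf]

theorem exists_mem_one_le_mult {P : Plane K} (h : 1 ≤ mult P s.prod) : ∃ g ∈ s, 1 ≤ mult P g := by
  by_contra! hcon
  rw [mult_multiset_prod, Multiset.sum_eq_zero] at h
  · exact absurd h (by simp)
  · intro x hx
    obtain ⟨g, hg, rfl⟩ := Multiset.mem_map.mp hx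
    exact Order.lt_one_iff.mp (hcon g hg)

theorem isCollinear_of_forall_mem {L : Line K} (h : ∀ P ∈ Z, P ∈ L.1) :
    Projectivization.IsCollinear (Z : Set (Plane K)) :=
  ⟨L.1, inferInstance, L.2.le, h⟩

theorem isCollinear_or_eq_intersectionPoints (hk1 : 1 ≤ k)
    (hs : ∀ g ∈ s, g.IsHomogeneous 1) (hs0 : ∀ g ∈ s, g ≠ 0)
    (hd : s.prod.IsHomogeneous d) (hk : ∀ P ∈ Z, (k : ℕ∞) ≤ mult P s.prod)
    (hmin : ∀ (q : MvPolynomial (Fin 3) K) (e : ℕ), q ≠ 0 → q.IsHomogeneous e →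
      (∀ P ∈ Z, ((k - 1 : ℕ) : ℕ∞) ≤ mult P q) → d ≤ e + 1) :
    Projectivization.IsCollinear (Z : Set (Plane K)) ∨
      (Z : Set (Plane K)) = (linesOf s hs hs0).intersectionPoints := by
  by_cases hcol : Projectivization.IsCollinear (Z : Set (Plane K))
  · exact Or.inl hcol
  refine Or.inr (Set.eq_of_subset_of_subset (fun P hP => ?_) ?_)
  · have hone {Q : Plane K} (hQ : Q ∈ Z) : ∃ g ∈ s, 1 ≤ mult Q g :=
      exists_mem_one_le_mult (le_trans (by exact_mod_cast hk1) (hk Q hQ))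
    obtain ⟨l, hl, hPl⟩ := hone hP
    by_contra hcon
    -- If `P` is not an intersection point, all the forms through `P` define the same line.
    have hL {m : MvPolynomial (Fin 3) K} (hm : m ∈ s) (hPm : 1 ≤ mult P m) :
        lineOf l (hs l hl) (hs0 l hl) = lineOf m (hs m hm) (hs0 m hm) := by
      by_contra hne
      exact hcon ⟨_, mem_linesOf.mpr ⟨l, hl, rfl⟩, _, mem_linesOf.mpr ⟨m, hm, rfl⟩, hne,
        (mem_lineOf_iff _ _ _).mpr hPl, (mem_lineOf_iff _ _ _).mpr hPm⟩
    obtain ⟨m, hm, hlm⟩ : ∃ (m : _) (hm : m ∈ s),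
        lineOf l (hs l hl) (hs0 l hl) ≠ lineOf m (hs m hm) (hs0 m hm) := by
      by_contra! hall
      refine hcol (isCollinear_of_forall_mem (L := lineOf l (hs l hl) (hs0 l hl)) fun Q hQ => ?_)
      obtain ⟨g, hg, hQg⟩ := hone hQ
      rw [hall g hg, mem_lineOf_iff]
      exact hQg
    obtain ⟨s', hs', Q, hQ, hQl, -, hlt⟩ := exists_mem_of_lineOf_ne hs hs0 hd hk hmin hl hm hlm
    refine hlt ?_
    have hmP : mult P m = 0 := by
      by_contra h
      exact hlm (hL hm (Order.one_le_iff_ne_zero.mpr h))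
    have h1 : ((k - 1 : ℕ) : ℕ∞) ≤ mult P s'.prod := by
      refine natCast_pred_le ((hk P hP).trans ?_)
      rw [hs', Multiset.prod_cons, Multiset.prod_cons, mult_mul, mult_mul, hmP, zero_add, add_comm]
      exact add_le_add_right (mult_le_one (hs l hl) (hs0 l hl) P) _
    -- Each remaining factor through `P` defines the line of `l`, which contains `Q`. Hence the
    -- multiplicity at `Q` is at least that at `P`.
    refine h1.trans ?_
    rw [mult_multiset_prod, mult_multiset_prod]
    refine Multiset.sum_map_le_sum_map _ _ fun x hx => ?_
    have hxs : x ∈ s := by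
      rw [hs']
      exact Multiset.mem_cons_of_mem (Multiset.mem_cons_of_mem hx)
    by_cases hPx : 1 ≤ mult P x
    · refine (mult_le_one (hs x hxs) (hs0 x hxs) P).trans ?_
      rwa [← mem_lineOf_iff (hs x hxs) (hs0 x hxs), ← hL hxs hPx]
    · rw [Order.one_le_iff_ne_zero, not_not] at hPx
      rw [hPx]
      exact zero_le
  · rintro R ⟨L, hL, M, hM, hLM, hRL, hRM⟩
    obtain ⟨l, hl, rfl⟩ := mem_linesOf.mp hL
    obtain ⟨m, hm, rfl⟩ := mem_linesOf.mp hM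
    obtain ⟨-, -, P, hP, hPl, hPm, -⟩ := exists_mem_of_lineOf_ne hs hs0 hd hk hmin hl hm hLM
    rw [eq_of_mem_lines hLM hRL hRM hPl hPm]
    exact hP

end Minimal

/-! ### Initial degrees and conclusion -/

theorem initialDegree_le {I : Ideal (MvPolynomial (Fin 3) K)} {n : ℕ} {f : MvPolynomial (Fin 3) K}
    (hf : f ∈ I) (h0 : f ≠ 0) (hn : f.IsHomogeneous n) : initialDegree I ≤ n :=
  Nat.sInf_le ⟨f, hf, h0, hn⟩

/-- The infimum of the empty set is `0`, so a nonzero value is attained. -/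
theorem exists_isHomogeneous_initialDegree {I : Ideal (MvPolynomial (Fin 3) K)}
    (h : initialDegree I ≠ 0) : ∃ f ∈ I, f ≠ 0 ∧ f.IsHomogeneous (initialDegree I) :=
  Nat.sInf_mem (Nat.nonempty_of_sInf_eq_succ (Nat.succ_pred_eq_of_ne_zero h).symm)

end PlanePoints

theorem mainTheorem4 {K : Type*} [Field K] [IsAlgClosed K] [CharZero K]
    (Z : Finset (PlanePoints.Plane K)) (k : ℕ) (hk : 2 ≤ k)
    (hα : PlanePoints.alphaDiff k (k - 1) Z = 1) :
    Projectivization.IsCollinear (Z : Set (PlanePoints.Plane K)) ∨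
      ∃ A : PlanePoints.LineArrangement K,
        (Z : Set (PlanePoints.Plane K)) = PlanePoints.LineArrangement.intersectionPoints A := by
  rw [PlanePoints.alphaDiff] at hα
  obtain ⟨f, hf, hf0, hfd⟩ := PlanePoints.exists_isHomogeneous_initialDegree
    (I := PlanePoints.symbolicPower Z k) (by omega)
  obtain ⟨s, hs, hsf⟩ := UniqueFactorizationMonoid.exists_prime_factors f hf0
  -- The product of the primes is only associated to `f`; the unit has degree zero, as `u * u⁻¹ = 1`
  -- shows.
  have hd : s.prod.IsHomogeneous (PlanePoints.initialDegree (PlanePoints.symbolicPower Z k)) := by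
    obtain ⟨u, rfl⟩ := hsf
    obtain ⟨h1, -, h2⟩ := PlanePoints.isHomogeneous_of_mul hfd hf0
    have h3 := (PlanePoints.isHomogeneous_of_mul (f := (u : MvPolynomial (Fin 3) K))
      (g := ((u⁻¹ : _ˣ) : MvPolynomial (Fin 3) K)) (n := 0)
      (by rw [Units.mul_inv]; exact MvPolynomial.isHomogeneous_one _ _)
      (by rw [Units.mul_inv]; exact one_ne_zero)).2.2
    rw [← h2]
    rwa [show (u : MvPolynomial (Fin 3) K).totalDegree = 0 by omega, add_zero]
  have hmult : ∀ P ∈ Z, (k : ℕ∞) ≤ PlanePoints.mult P s.prod := fun P hP => by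
    rw [PlanePoints.mult_eq_of_associated hsf]
    exact (PlanePoints.mem_symbolicPower_iff hfd).mp hf P hP
  have hmin : ∀ (q : MvPolynomial (Fin 3) K) (e : ℕ), q ≠ 0 → q.IsHomogeneous e →
      (∀ P ∈ Z, ((k - 1 : ℕ) : ℕ∞) ≤ PlanePoints.mult P q) →
      PlanePoints.initialDegree (PlanePoints.symbolicPower Z k) ≤ e + 1 := by
    intro q e hq0 hq hqZ
    have := PlanePoints.initialDegree_le ((PlanePoints.mem_symbolicPower_iff hq).mpr hqZ) hq0 hq
    omega
  have hs1 (g) (hg : g ∈ s) := PlanePoints.isHomogeneous_one_of_mem hs hd hmult hmin hg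
  exact (PlanePoints.isCollinear_or_eq_intersectionPoints (by omega) hs1
    (fun g hg => (hs g hg).ne_zero) hd hmult hmin).imp_right fun h => ⟨_, h⟩
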